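/- For an integer $k\ge 2$ let $\mathcal L_k=\mathbb Z_k\wr\mathbb Z=\bigl(\bigoplus_{n\in\mathbb Z}\mathbb Z_k\bigr)\rtimes\langle\xi\rangle$ be the lamplighter group, where $\xi$ has infinite order and acts by shifting the coordinates by one, and let $\mathbb Z_k^*$ be the group of units of the ring $\mathbb Z_k=\mathbb Z/k\mathbb Z$. Let $\mathrm{Aut}_+(\mathcal L_k)$ be the subgroup of $\mathrm{Aut}(\mathcal L_k)$ consisting of the automorphisms that send $\xi$ to $u\xi$ for some $u\in\bigoplus_{n\in\mathbb Z}\mathbb Z_k$. A group $G$ is a finite extension of a group $H$ if $G$ has a subgroup of finite index isomorphic to $H$. Let $p_1,\dots,p_s$ be the distinct prime divisors of $k$. Then the following conditions are equivalent: (i) $k$ is squarefree; (ii) $\mathrm{Aut}(\mathcal L_k)$ is finitely generated; (iii) $\mathrm{Aut}_+(\mathcal L_k)$ is a finite extension of a semidirect product $\mathcal L_k\rtimes(\mathbb Z^{s-1}\times\mathbb Z_k^*)$, for some action of $\mathbb Z^{s-1}\times\mathbb Z_k^*$ on $\mathcal L_k$ by automorphisms. If in addition $p_i$ divides $(k/p_i)^2-1$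 for $i=1,\dots,s$, then, for some such action and some action of the cyclic group $C_2$ of order $2$ on the resulting semidirect product, $$\mathrm{Aut}_+(\mathcal L_k)\cong\mathcal L_k\rtimes(\mathbb Z^{s-1}\times\mathbb Z_k^*)\quad\text{and}\quad \mathrm{Aut}(\mathcal L_k)\cong\bigl(\mathcal L_k\rtimes(\mathbb Z^{s-1}\times\mathbb Z_k^*)\bigr)\rtimes C_2,$$ where the same semidirect product $\mathcal L_k\rtimes(\mathbb Z^{s-1}\times\mathbb Z_k^*)$ occurs in both isomorphisms. -/

import Mathlib

namespace Lamplighter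

/-- The direct sum of copies of the cyclic group of order `k` indexed by `ℤ`, written
multiplicatively: families `ℤ → ZMod k` with finite support. -/
abbrev Lamps (k : ℕ) : Type := Multiplicative (ℤ →₀ ZMod k)

/-- The shift action of the infinite cyclic group on the lamps: the integer `m` moves the entry at
position `n` to position `m + n`. -/
noncomputable def shift (k : ℕ) : Multiplicative ℤ →* MulAut (Lamps k) where
  toFun m := AddEquiv.toMultiplicative (Finsupp.domCongr (Equiv.addLeft m.toAdd))
  map_one' := by
    ext f : 1
    apply Multiplicative.toAdd.injective
    ext n
    change f.toAdd (-(0 : ℤ) + n) = f.toAdd n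
    simp
  map_mul' a b := by
    ext f : 1
    apply Multiplicative.toAdd.injective
    ext n
    change f.toAdd (-(a.toAdd + b.toAdd) + n) = f.toAdd (-b.toAdd + (-a.toAdd + n))
    congr 1
    ring

theorem shift_single (k : ℕ) (m n : ℤ) (c : ZMod k) :
    shift k (Multiplicative.ofAdd m) (Multiplicative.ofAdd (Finsupp.single n c)) =
      Multiplicative.ofAdd (Finsupp.single (m + n) c) := by
  apply Multiplicative.toAdd.injective
  change Finsupp.domCongr (Equiv.addLeft m) (Finsupp.single n c) = Finsupp.single (m + n) c
  simp

/-- The lamplighter group `L_k`, the restricted wreath product of the cyclic group of order `k`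
by `ℤ`. -/
abbrev LGroup (k : ℕ) : Type := Lamps k ⋊[shift k] Multiplicative ℤ

/-- The generator `ξ` of the acting infinite cyclic group. -/
noncomputable def xi (k : ℕ) : LGroup k := SemidirectProduct.inr (Multiplicative.ofAdd 1)

/-- The exponent of `ξ` in the normal form of `x`, that is, the `r` with `x = u * ξ ^ r` for an
element `u` of the lamps. -/
noncomputable def exponent {k : ℕ} (x : LGroup k) : ℤ := (SemidirectProduct.right x).toAdd

theorem exponent_mul {k : ℕ} (x y : LGroup k) : exponent (x * y) = exponent x + exponent y := rfl

theorem exponent_map {k : ℕ} (hk : k ≠ 0) (φ : MulAut (LGroup k)) (x : LGroup k) :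
    exponent (φ x) = exponent (φ (xi k)) * exponent x := by
  let e : LGroup k →* Multiplicative ℤ :=
    (SemidirectProduct.rightHom).comp φ.toMonoidHom
  have he : ∀ y, exponent (φ y) = (e y).toAdd := fun _ => rfl
  have h1 : x = SemidirectProduct.inl x.left * xi k ^ exponent x := by
    have : xi k ^ exponent x = SemidirectProduct.inr x.right := by
      rw [xi, ← map_zpow, ← ofAdd_zsmul]
      simp [exponent]
    rw [this, SemidirectProduct.inl_left_mul_inr_right]
  have h2 : ∀ u : Lamps k, (e (SemidirectProduct.inl u)).toAdd = 0 := by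
    intro u
    have hu : u ^ k = 1 := by
      apply Multiplicative.toAdd.injective
      ext n
      simp
    have h3 : e (SemidirectProduct.inl u) ^ k = 1 := by
      rw [← map_pow, ← map_pow, hu, map_one, map_one]
    have h4 := congrArg Multiplicative.toAdd h3
    simpa [hk] using h4
  rw [he, he]
  conv_lhs => rw [h1]
  rw [map_mul, map_zpow, toAdd_mul, h2, toAdd_zpow]
  simp [mul_comm]

/-- The subgroup `Aut₊(L_k)` of positive automorphisms: those sending `ξ` to an element of the form
`u * ξ` with `u` in the lamps. -/
noncomputable def autPlus (k : ℕ) [NeZero k] : Subgroup (MulAut (LGroup k)) where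
  carrier := {φ | exponent (φ (xi k)) = 1}
  one_mem' := by simp [exponent, xi]
  mul_mem' {φ ψ} hφ hψ := by
    simp only [Set.mem_ofPred_eq] at hφ hψ ⊢
    rw [MulAut.mul_apply, exponent_map (NeZero.ne k) φ, hφ, hψ, one_mul]
  inv_mem' {φ} hφ := by
    simp only [Set.mem_ofPred_eq] at hφ ⊢
    have h := exponent_map (NeZero.ne k) φ (φ⁻¹ (xi k))
    rw [MulAut.apply_inv_self, hφ, one_mul] at h
    rw [← h]
    simp [exponent, xi]

/-- The group `ℤ^(s-1) × (ℤ/kℤ)ˣ`, where `s` is the number of prime divisors of `k`, with the first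
factor written multiplicatively. -/
abbrev Complement (k : ℕ) : Type :=
  Multiplicative (Fin (k.primeFactors.card - 1) → ℤ) × (ZMod k)ˣ

/-- `G` is a finite extension of `H`: some subgroup of finite index of `G` is isomorphic to `H`. -/
def IsFiniteExtension (G H : Type*) [Group G] [Group H] : Prop :=
  ∃ K : Subgroup G, K.FiniteIndex ∧ Nonempty (K ≃* H)

end Lamplighter

/-! Write R for the Laurent polynomials over Z/k. The lamps are R as an additive group, with ξ
acting as multiplication by T. A positive automorphism is R-linear on the lamps, hence
multiplication by a unit, and sends ξ to uξ with u arbitrary; so Aut₊ is the affine group R ⋊ Rˣ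
(`affineEquiv`), and L_k is its subgroup R ⋊ ⟨T⟩.

If k is squarefree, a unit of R is a constant unit times an independent power of T at each of the s
primes. Splitting off the diagonal ⟨T⟩ leaves Z^(s-1) × (Z/k)ˣ (`exists_complement_units`), which
complements L_k in the affine group. If k is not squarefree, Rˣ contains infinitely many elements of
exponent k, so this abelian quotient of Aut₊ is not finitely generated (`not_fg_units`).

Aut₊ is the kernel of the sign of the exponent of φ(ξ), and the reflection splits off C₂
(`exists_mulEquiv_mulAut`), so finite generation passes between Aut and Aut₊. The divisibility
condition merely forces k to be squarefree. -/

namespace LaurentPolynomial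

/-! ### Units of Laurent polynomials over a field. -/

/-- Every unit of the Laurent polynomials over a field is a monomial. -/
theorem exists_eq_C_mul_T_of_isUnit {F : Type*} [Field F] {f : LaurentPolynomial F}
    (hf : IsUnit f) : ∃ (r : F) (n : ℤ), r ≠ 0 ∧ f = C r * T n := by
  obtain ⟨g, hg⟩ := hf.exists_right_inv
  obtain ⟨a, f', hf'⟩ := exists_T_pow f
  obtain ⟨b, g', hg'⟩ := exists_T_pow g
  -- Clearing negative powers turns f and g into polynomials; since X is prime, a factor of a power
  -- of X is itself a power of X up to a unit.
  have h : f' * g' = Polynomial.X ^ (a + b) := by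
    apply Polynomial.toLaurent_injective
    rw [map_mul, hf', hg', Polynomial.toLaurent_X_pow, Nat.cast_add, T_add]
    linear_combination (T (a : ℤ) * T (b : ℤ)) * hg
  obtain ⟨n, -, hn⟩ := (dvd_prime_pow Polynomial.prime_X _).1 (Dvd.intro _ h)
  obtain ⟨u, hu⟩ := hn.symm
  obtain ⟨r, hr, hru⟩ := Polynomial.isUnit_iff.1 u.isUnit
  refine ⟨r, n - a, hr.ne_zero, ?_⟩
  have h2 : f * T (a : ℤ) = T (n : ℤ) * C r := by
    rw [← hf', ← hu, ← hru, map_mul, Polynomial.toLaurent_X_pow, Polynomial.toLaurent_C]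
  calc f = f * T (a : ℤ) * T (-(a : ℤ)) := by rw [mul_T_assoc]; simp
    _ = C r * T (n - a) := by rw [h2, T_sub]; ring

end LaurentPolynomial

/-! ### Chinese remainders for squarefree k. -/

namespace ZMod

variable {k : ℕ}

theorem eq_zero_of_forall_castHom_eq_zero (hk : Squarefree k) {x : ZMod k}
    (hx : ∀ p (hp : p ∈ k.primeFactors),
      castHom (Nat.dvd_of_mem_primeFactors hp) (ZMod p) x = 0) : x = 0 := by
  have : NeZero k := ⟨hk.ne_zero⟩
  rw [← natCast_zmod_val x, natCast_eq_zero_iff]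
  refine (Nat.prod_primeFactors_of_squarefree hk).symm.dvd.trans
    (Finset.prod_primes_dvd _ (fun p hp => (Nat.prime_of_mem_primeFactors hp).prime) ?_)
  intro p hp
  have h := hx p hp
  rw [← natCast_zmod_val x, map_natCast, natCast_eq_zero_iff] at h
  exact h

theorem exists_forall_castHom_eq (hk : Squarefree k) (p : ℕ) (hp : p ∈ k.primeFactors) :
    ∃ e : ZMod k, ∀ q (hq : q ∈ k.primeFactors),
      castHom (Nat.dvd_of_mem_primeFactors hq) (ZMod q) e = if q = p then 1 else 0 := by
  have hpp := Nat.prime_of_mem_primeFactors hp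
  have hkp : k = p * (k / p) := (Nat.mul_div_cancel' (Nat.dvd_of_mem_primeFactors hp)).symm
  have hcop : Nat.Coprime p (k / p) := by
    apply Nat.coprime_of_squarefree_mul
    rwa [← hkp]
  obtain ⟨z, hz1, hz0⟩ := Nat.chineseRemainder hcop 1 0
  refine ⟨(z : ZMod k), fun q hq => ?_⟩
  rw [map_natCast]
  split_ifs with h
  · subst h
    exact_mod_cast (natCast_eq_natCast_iff _ _ _).2 hz1
  · have hqk : q ∣ k / p := by
      have h2 := Nat.dvd_of_mem_primeFactors hq
      rw [hkp] at h2
      refine ((Nat.prime_of_mem_primeFactors hq).dvd_mul.1 h2).resolve_left fun h3 => h ?_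
      exact (Nat.prime_dvd_prime_iff_eq (Nat.prime_of_mem_primeFactors hq) hpp).1 h3
    rw [natCast_eq_zero_iff]
    exact hqk.trans (Nat.modEq_zero_iff_dvd.1 hz0)

end ZMod

/-! ### Units of R for squarefree k. -/

namespace Lamplighter

open LaurentPolynomial

/-- Reduction of Laurent polynomials over `ZMod k` modulo a divisor of `k`. -/
noncomputable def reduction {k q : ℕ} (h : q ∣ k) :
    LaurentPolynomial (ZMod k) →+* LaurentPolynomial (ZMod q) :=
  AddMonoidAlgebra.mapRingHom ℤ (ZMod.castHom h (ZMod q))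

theorem coeff_reduction {k q : ℕ} (h : q ∣ k) (f : LaurentPolynomial (ZMod k)) (n : ℤ) :
    (reduction h f).coeff n = ZMod.castHom h (ZMod q) (f.coeff n) :=
  AddMonoidAlgebra.coeff_mapRingHom _ _ _

theorem reduction_T {k q : ℕ} (h : q ∣ k) (n : ℤ) : reduction h (T n) = T n := by
  ext m
  rw [coeff_reduction, T_apply, T_apply, apply_ite (ZMod.castHom h (ZMod q)), map_one, map_zero]

theorem reduction_C {k q : ℕ} (h : q ∣ k) (r : ZMod k) :
    reduction h (C r) = C (ZMod.castHom h (ZMod q) r) := by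
  ext m
  rw [coeff_reduction, C_apply, C_apply, apply_ite (ZMod.castHom h (ZMod q)), map_zero]

variable {k : ℕ}

/-- R embeds in the product of the Laurent polynomial rings over the prime fields, so identities can
be checked one prime at a time. -/
theorem eq_of_forall_reduction_eq (hk : Squarefree k) {f g : LaurentPolynomial (ZMod k)}
    (h : ∀ p (hp : p ∈ k.primeFactors), reduction (Nat.dvd_of_mem_primeFactors hp) f =
      reduction (Nat.dvd_of_mem_primeFactors hp) g) : f = g := by
  ext n
  rw [← sub_eq_zero]
  refine ZMod.eq_zero_of_forall_castHom_eq_zero hk fun p hp => ?_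
  rw [map_sub, ← coeff_reduction, ← coeff_reduction, h p hp, sub_self]

variable (hk : Squarefree k)

/-- The primitive idempotent of `ZMod k` at the prime `p`, for squarefree `k`. -/
noncomputable def idem (p : k.primeFactors) : ZMod k :=
  (ZMod.exists_forall_castHom_eq hk p p.2).choose

theorem castHom_idem (p q : k.primeFactors) :
    ZMod.castHom (Nat.dvd_of_mem_primeFactors q.2) (ZMod q) (idem hk p) =
      if q = p then 1 else 0 := by
  rw [idem, (ZMod.exists_forall_castHom_eq hk p p.2).choose_spec q q.2]
  exact if_congr Subtype.ext_iff.symm rfl rfl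

/-- The Laurent polynomial that reduces to `T (n p)` modulo `p`, for every prime `p` dividing
`k`. -/
noncomputable def multiT (n : k.primeFactors → ℤ) : LaurentPolynomial (ZMod k) :=
  ∑ p, C (idem hk p) * T (n p)

theorem reduction_multiT (n : k.primeFactors → ℤ) (q : k.primeFactors) :
    reduction (Nat.dvd_of_mem_primeFactors q.2) (multiT hk n) = T (n q) := by
  rw [multiT, map_sum, Finset.sum_eq_single q]
  · rw [map_mul, reduction_T, reduction_C, castHom_idem, if_pos rfl, map_one, one_mul]
  · intro p _ hp
    rw [map_mul, reduction_C, castHom_idem, if_neg hp.symm, map_zero, zero_mul]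
  · exact fun h => absurd (Finset.mem_univ q) h

theorem multiT_const (m : ℤ) : multiT hk (fun _ => m) = T m :=
  eq_of_forall_reduction_eq hk fun p hp => by
    rw [reduction_multiT hk _ ⟨p, hp⟩, reduction_T]

theorem multiT_zero : multiT hk 0 = 1 :=
  (multiT_const hk 0).trans T_zero

theorem multiT_add (m n : k.primeFactors → ℤ) :
    multiT hk (m + n) = multiT hk m * multiT hk n :=
  eq_of_forall_reduction_eq hk fun p hp => by
    rw [map_mul, reduction_multiT hk _ ⟨p, hp⟩, reduction_multiT hk _ ⟨p, hp⟩,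
      reduction_multiT hk _ ⟨p, hp⟩, Pi.add_apply, T_add]

/-- `multiT` as a homomorphism to the units. -/
noncomputable def multiTHom :
    Multiplicative (k.primeFactors → ℤ) →* (LaurentPolynomial (ZMod k))ˣ :=
  MonoidHom.toHomUnits
    { toFun n := multiT hk n.toAdd
      map_one' := multiT_zero hk
      map_mul' _ _ := multiT_add hk _ _ }

/-- The product of a constant unit and of a value of `multiT`. -/
noncomputable def unitsHom :
    (ZMod k)ˣ × Multiplicative (k.primeFactors → ℤ) →* (LaurentPolynomial (ZMod k))ˣ :=
  (Units.map (C : ZMod k →+* LaurentPolynomial (ZMod k)).toMonoidHom).coprod (multiTHom hk)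

theorem val_unitsHom (x : (ZMod k)ˣ × Multiplicative (k.primeFactors → ℤ)) :
    (unitsHom hk x : LaurentPolynomial (ZMod k)) = C (x.1 : ZMod k) * multiT hk x.2.toAdd := rfl

/-- The degree modulo p recovers the exponent at p; once these vanish, the coefficient at 0 recovers
the constant. -/
theorem unitsHom_injective : Function.Injective (unitsHom hk) := by
  rw [injective_iff_map_eq_one]
  rintro ⟨c, n⟩ h
  have h1 := congrArg Units.val h
  rw [val_unitsHom, Units.val_one] at h1
  have h2 : n = 1 := by
    apply Multiplicative.toAdd.injective
    funext p
    have hp : Fact (p : ℕ).Prime := ⟨Nat.prime_of_mem_primeFactors p.2⟩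
    have h3 := congrArg (reduction (Nat.dvd_of_mem_primeFactors p.2)) h1
    rw [map_mul, reduction_C, reduction_multiT, map_one] at h3
    have h4 := congrArg degree h3
    rw [degree_C_mul_T _ _ (c.isUnit.map _).ne_zero, ← T_zero, degree_T] at h4
    exact_mod_cast h4
  subst h2
  rw [toAdd_one, multiT_zero, mul_one] at h1
  have h6 := congrArg (fun f => f.coeff 0) h1
  simp only [C_apply, if_true, ← T_zero, T_apply] at h6
  exact Prod.ext (Units.ext h6) rfl

theorem unitsHom_surjective : Function.Surjective (unitsHom hk) := by
  intro u
  have h1 : ∀ p : k.primeFactors, ∃ (r : ZMod p) (n : ℤ),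
      reduction (Nat.dvd_of_mem_primeFactors p.2) (u : LaurentPolynomial (ZMod k)) =
        C r * T n := by
    intro p
    have hp : Fact (p : ℕ).Prime := ⟨Nat.prime_of_mem_primeFactors p.2⟩
    obtain ⟨r, n, -, h⟩ := exists_eq_C_mul_T_of_isUnit
      (u.isUnit.map (reduction (Nat.dvd_of_mem_primeFactors p.2)))
    exact ⟨r, n, h⟩
  choose r n hrn using h1
  -- Removing the power of T at each prime leaves a unit that is constant modulo every prime, hence
  -- constant.
  set w := u * multiTHom hk (Multiplicative.ofAdd (-n)) with hw
  have hwv : (w : LaurentPolynomial (ZMod k)) = u * multiT hk (-n) := rfl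
  have h2 : ∀ u : (LaurentPolynomial (ZMod k))ˣ, (∀ p : k.primeFactors, ∃ r : ZMod p,
      reduction (Nat.dvd_of_mem_primeFactors p.2) (u : LaurentPolynomial (ZMod k)) = C r) →
      (u : LaurentPolynomial (ZMod k)) = C ((u : LaurentPolynomial (ZMod k)).coeff 0) := by
    intro u hu
    refine eq_of_forall_reduction_eq hk fun p hp => ?_
    obtain ⟨r, hr⟩ := hu ⟨p, hp⟩
    rw [reduction_C, ← coeff_reduction, hr, C_apply, if_pos rfl]
  have h3 : ∀ p : k.primeFactors,
      reduction (Nat.dvd_of_mem_primeFactors p.2) (w : LaurentPolynomial (ZMod k)) = C (r p) := by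
    intro p
    rw [hwv, map_mul, hrn, reduction_multiT, Pi.neg_apply, mul_T_assoc, add_neg_cancel, T_zero,
      mul_one]
  have h4 := h2 w fun p => ⟨_, h3 p⟩
  -- Evaluating at T = 1 shows that this constant is a unit of Z/k.
  have h5 : IsUnit ((w : LaurentPolynomial (ZMod k)).coeff 0) := by
    have h6 := w.isUnit.map (eval₂ (RingHom.id (ZMod k)) 1)
    rw [h4, eval₂_C] at h6
    exact h6
  refine ⟨(h5.unit, Multiplicative.ofAdd n), ?_⟩
  ext1
  rw [val_unitsHom]
  change C ((w : LaurentPolynomial (ZMod k)).coeff 0) * multiT hk n = u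
  rw [← h4, hwv, mul_assoc, ← multiT_add, neg_add_cancel, multiT_zero, mul_one]

/-- Integer vectors indexed by `ι` are sums of a constant vector and of a vector that vanishes at
a base point. -/
def splitConst {ι : Type*} {n : ℕ} (e : ι ≃ Fin (n + 1)) :
    (ℤ × (Fin n → ℤ)) ≃+ (ι → ℤ) where
  toFun x i := x.1 + (Fin.cons 0 x.2 : Fin (n + 1) → ℤ) (e i)
  invFun w := (w (e.symm 0), fun i => w (e.symm i.succ) - w (e.symm 0))
  left_inv x := by simp
  right_inv w := by
    funext i
    obtain ⟨j, rfl⟩ := e.symm.surjective i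
    cases j using Fin.cases <;> simp
  map_add' x y := by
    funext i
    obtain ⟨j, rfl⟩ := e.symm.surjective i
    cases j using Fin.cases
    · simp
    · simp only [Equiv.apply_symm_apply, Prod.fst_add, Prod.snd_add, Fin.cons_succ, Pi.add_apply]
      ring

/-- The unit `T ^ m` of the Laurent polynomials. -/
noncomputable def unitT (k : ℕ) : Multiplicative ℤ →* (LaurentPolynomial (ZMod k))ˣ :=
  MonoidHom.toHomUnits
    { toFun m := T m.toAdd
      map_one' := T_zero
      map_mul' _ _ := T_add _ _ }

theorem val_unitT (m : Multiplicative ℤ) : (unitT k m : LaurentPolynomial (ZMod k)) = T m.toAdd :=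
  rfl

/-- In Z^s the powers of T are the constant vectors; the vectors vanishing at one chosen prime form
a complement Z^(s-1). -/
theorem exists_complement_units (hk : Squarefree k) (h2 : 2 ≤ k) :
    ∃ κ : Complement k →* (LaurentPolynomial (ZMod k))ˣ,
      Function.Bijective fun x : Multiplicative ℤ × Complement k => unitT k x.1 * κ x.2 := by
  -- As k ≥ 2 has a prime factor, the truncated subtraction s - 1 loses nothing.
  have hcard : k.primeFactors.card = k.primeFactors.card - 1 + 1 :=
    (Nat.succ_pred_eq_of_pos (Finset.card_pos.2 (Nat.nonempty_primeFactors.2 h2))).symm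
  let e := splitConst (k.primeFactors.equivFin.trans (finCongr hcard))
  let κ : Complement k →* (LaurentPolynomial (ZMod k))ˣ := (unitsHom hk).comp
    ((MonoidHom.snd _ _).prod
      ((AddMonoidHom.toMultiplicative
        (e.toAddMonoidHom.comp (AddMonoidHom.inr ℤ _))).comp (MonoidHom.fst _ _)))
  refine ⟨κ, ?_⟩
  have h : (fun x : Multiplicative ℤ × Complement k => unitT k x.1 * κ x.2) =
      unitsHom hk ∘ fun x => (x.2.2, Multiplicative.ofAdd (e (x.1.toAdd, x.2.1.toAdd))) := by
    funext x
    have h3 : e (x.1.toAdd, x.2.1.toAdd) = (fun _ => x.1.toAdd) + e (0, x.2.1.toAdd) := by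
      funext i
      simp [e, splitConst]
    ext1
    rw [Function.comp_apply, val_unitsHom, Units.val_mul, val_unitT]
    dsimp only [toAdd_ofAdd]
    rw [h3, multiT_add, multiT_const]
    change T x.1.toAdd * (C (x.2.2 : ZMod k) * multiT hk (e (0, x.2.1.toAdd))) = _
    ring
  rw [h]
  refine Function.Bijective.comp ⟨unitsHom_injective hk, unitsHom_surjective hk⟩ ⟨?_, ?_⟩
  · rintro ⟨m, v, c⟩ ⟨m', v', c'⟩ hx
    have h5 := congrArg Prod.fst hx
    have h6 := e.injective (congrArg Prod.snd hx)
    have h7 := congrArg Prod.fst h6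
    have h8 := congrArg Prod.snd h6
    exact Prod.ext h7 (Prod.ext h8 h5)
  · rintro ⟨c, w⟩
    refine ⟨(Multiplicative.ofAdd (e.symm w.toAdd).1,
      Multiplicative.ofAdd (e.symm w.toAdd).2, c), ?_⟩
    exact Prod.ext rfl (e.apply_symm_apply w.toAdd)

/-! ### Infinitely many torsion units when k is not squarefree. -/

/-- The unit `1 + r * T ^ j`, for `r` of square zero. -/
noncomputable def nilpotentUnit {r : ZMod k} (hr : r * r = 0) (j : ℤ) :
    (LaurentPolynomial (ZMod k))ˣ where
  val := 1 + C r * T j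
  inv := 1 - C r * T j
  val_inv := by
    have h : (C r * C r : LaurentPolynomial (ZMod k)) = 0 := by rw [← map_mul, hr, map_zero]
    linear_combination -(T j * T j) * h
  inv_val := by
    have h : (C r * C r : LaurentPolynomial (ZMod k)) = 0 := by rw [← map_mul, hr, map_zero]
    linear_combination -(T j * T j) * h

theorem nilpotentUnit_injective {r : ZMod k} (hr : r * r = 0) (h0 : r ≠ 0) :
    Function.Injective (nilpotentUnit hr) := by
  intro i j h
  have h1 : (1 + C r * T i : LaurentPolynomial (ZMod k)) = 1 + C r * T j := congrArg Units.val h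
  have h2 := congrArg degree (add_left_cancel h1)
  rw [degree_C_mul_T _ _ h0, degree_C_mul_T _ _ h0] at h2
  exact_mod_cast h2

theorem nilpotentUnit_pow {r : ZMod k} (hr : r * r = 0) (j : ℤ) : nilpotentUnit hr j ^ k = 1 := by
  have h : ∀ n : ℕ, (1 + C r * T j : LaurentPolynomial (ZMod k)) ^ n =
      1 + C (n * r) * T j := by
    intro n
    induction n with
    | zero => simp
    | succ n ih =>
      have h : (C r * C r : LaurentPolynomial (ZMod k)) = 0 := by rw [← map_mul, hr, map_zero]
      rw [pow_succ, ih, Nat.cast_succ, map_mul, map_mul, map_add, map_one]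
      linear_combination (C (n : ZMod k) * T j * T j) * h
  ext1
  rw [Units.val_pow_eq_pow_val, Units.val_one]
  change (1 + C r * T j : LaurentPolynomial (ZMod k)) ^ k = 1
  rw [h, ZMod.natCast_self, zero_mul, map_zero, zero_mul, add_zero]

/-- The n-torsion is a submodule of a finitely generated Z-module, so it is finitely generated and
torsion, hence finite. -/
theorem finite_setOf_pow_eq_one {G : Type*} [CommGroup G] [Group.FG G] {n : ℕ} (hn : n ≠ 0) :
    {x : G | x ^ n = 1}.Finite := by
  have : Module.Finite ℤ (Additive G) := Module.Finite.iff_addGroup_fg.2 inferInstance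
  let K := LinearMap.ker (LinearMap.lsmul ℤ (Additive G) n)
  have hK : Module.IsTorsion ℤ K := fun x =>
    ⟨⟨(n : ℤ), mem_nonZeroDivisors_of_ne_zero (by exact_mod_cast hn)⟩, Subtype.ext x.2⟩
  have hfin : Finite K := Module.finite_of_fg_torsion _ hK
  refine Set.Finite.subset ((Set.toFinite (K : Set (Additive G))).image Additive.toMul) ?_
  intro x hx
  refine ⟨Additive.ofMul x, ?_, rfl⟩
  change (n : ℤ) • Additive.ofMul x = 0
  rw [natCast_zsmul, ← ofMul_pow, hx, ofMul_one]

theorem not_fg_units (h0 : k ≠ 0) (hk : ¬ Squarefree k) :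
    ¬ Group.FG (LaurentPolynomial (ZMod k))ˣ := by
  intro hfg
  rw [Nat.squarefree_iff_prime_squarefree] at hk
  push Not at hk
  obtain ⟨p, hp, m, rfl⟩ := hk
  -- The witness k / p is nonzero modulo k, but its square is a multiple of k because p² divides k.
  have hr : ((p * m : ℕ) : ZMod (p * p * m)) * ((p * m : ℕ) : ZMod (p * p * m)) = 0 := by
    rw [← Nat.cast_mul, ZMod.natCast_eq_zero_iff]
    exact ⟨m, by ring⟩
  have hr0 : ((p * m : ℕ) : ZMod (p * p * m)) ≠ 0 := by
    rw [Ne, ZMod.natCast_eq_zero_iff, mul_assoc]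
    intro h
    have hpm : 0 < p * m := Nat.pos_of_ne_zero fun h => h0 (by rw [mul_assoc, h, mul_zero])
    have h1 := Nat.le_of_dvd hpm h
    nlinarith [hp.two_le]
  exact Set.infinite_range_of_injective (nilpotentUnit_injective hr hr0)
    ((finite_setOf_pow_eq_one h0).subset (Set.range_subset_iff.2 (nilpotentUnit_pow hr)))

end Lamplighter

/-! ### Generalities on semidirect products. -/

/-- A group with two complementary subgroups, the first of them normal, is a semidirect product. -/
theorem SemidirectProduct.exists_mulEquiv {N H G : Type*} [Group N] [Group H] [Group G]
    (ι : N →* G) (κ : H →* G) (hn : ι.range.Normal)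
    (hb : Function.Bijective fun x : N × H => ι x.1 * κ x.2) :
    ∃ φ : H →* MulAut N, Nonempty (G ≃* N ⋊[φ] H) := by
  have hι : Function.Injective ι := by
    intro a b h
    have h2 : ((a, 1) : N × H) = (b, 1) := hb.1 (by simp [h])
    exact congrArg Prod.fst h2
  let e : N ≃* ι.range := MonoidHom.ofInjective hι
  let φ : H →* MulAut N :=
    (MulAut.congr e.symm).toMonoidHom.comp (MulAut.conjNormal.comp κ)
  have hφ : ∀ h n, ι (φ h n) = κ h * ι n * (κ h)⁻¹ := by
    intro h n
    change ((e (e.symm (MulAut.conjNormal (κ h) (e n))) : ι.range) : G) = _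
    rw [MulEquiv.apply_symm_apply, MulAut.conjNormal_apply]
    rfl
  refine ⟨φ, ⟨(MulEquiv.ofBijective (SemidirectProduct.lift ι κ fun h => ?_) ?_).symm⟩⟩
  · ext n
    exact hφ h n
  · exact hb.comp SemidirectProduct.equivProd.bijective

theorem SemidirectProduct.group_fg {N H : Type*} [Group N] [Group H] {φ : H →* MulAut N}
    (hN : Group.FG N) (hH : Group.FG H) : Group.FG (N ⋊[φ] H) := by
  obtain ⟨S, hS, hSf⟩ := Group.fg_iff.1 hN
  obtain ⟨T, hT, hTf⟩ := Group.fg_iff.1 hH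
  refine Group.fg_iff.2 ⟨inl '' S ∪ inr '' T, ?_, (hSf.image _).union (hTf.image _)⟩
  rw [Subgroup.closure_union]
  have h1 : Subgroup.closure (inl '' S : Set (N ⋊[φ] H)) = (inl : N →* N ⋊[φ] H).range := by
    rw [← MonoidHom.map_closure, hS, MonoidHom.range_eq_map]
  have h2 : Subgroup.closure (inr '' T : Set (N ⋊[φ] H)) = (inr : H →* N ⋊[φ] H).range := by
    rw [← MonoidHom.map_closure, hT, MonoidHom.range_eq_map]
  rw [h1, h2, eq_top_iff]
  intro x _
  rw [← inl_left_mul_inr_right x]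
  exact Subgroup.mul_mem_sup ⟨_, rfl⟩ ⟨_, rfl⟩

/-! ### The affine group of R and its action on L_k. -/

namespace Lamplighter

open LaurentPolynomial SemidirectProduct

variable {k : ℕ}

/-- The lamps as an additive group are the Laurent polynomials. -/
noncomputable def lampsEquiv (k : ℕ) : Multiplicative (LaurentPolynomial (ZMod k)) ≃* Lamps k :=
  AddEquiv.toMultiplicative AddMonoidAlgebra.coeffAddEquiv

/-- The Laurent polynomial with the same coefficients as a family of lamps. -/
noncomputable def lampsPoly (a : Lamps k) : LaurentPolynomial (ZMod k) :=
  ((lampsEquiv k).symm a).toAdd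

theorem lampsPoly_mul (a b : Lamps k) : lampsPoly (a * b) = lampsPoly a + lampsPoly b := rfl

theorem lampsPoly_injective : Function.Injective (lampsPoly (k := k)) :=
  Multiplicative.toAdd.injective.comp (lampsEquiv k).symm.injective

/-- The family of lamps with the coefficients of a Laurent polynomial. -/
noncomputable def polyLamps (f : LaurentPolynomial (ZMod k)) : Lamps k :=
  lampsEquiv k (Multiplicative.ofAdd f)

@[simp]
theorem lampsPoly_polyLamps (f : LaurentPolynomial (ZMod k)) : lampsPoly (polyLamps f) = f := rfl

theorem polyLamps_add (f g : LaurentPolynomial (ZMod k)) :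
    polyLamps (f + g) = polyLamps f * polyLamps g := rfl

theorem lampsPoly_shift (m : Multiplicative ℤ) (a : Lamps k) :
    lampsPoly (shift k m a) = T m.toAdd * lampsPoly a := by
  ext n
  change a.toAdd (-m.toAdd + n) = _
  rw [T, AddMonoidAlgebra.coeff_single_mul_eq_mul_coeff (-m.toAdd + n), one_mul]
  · rfl
  · intro j _
    rw [eq_neg_add_iff_add_eq]

/-- The action of the units of the Laurent polynomials on the lamps by multiplication. -/
noncomputable def unitsAction (k : ℕ) : (LaurentPolynomial (ZMod k))ˣ →* MulAut (Lamps k) where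
  toFun w :=
    { toFun a := polyLamps (w * lampsPoly a)
      invFun a := polyLamps ((w⁻¹ : (LaurentPolynomial (ZMod k))ˣ) * lampsPoly a)
      left_inv a := lampsPoly_injective (by simp)
      right_inv a := lampsPoly_injective (by simp)
      map_mul' a b := lampsPoly_injective (by
        simp only [lampsPoly_mul, lampsPoly_polyLamps, mul_add]) }
  map_one' := by
    ext1 a
    exact lampsPoly_injective (one_mul _)
  map_mul' v w := by
    ext1 a
    exact lampsPoly_injective (mul_assoc _ _ _)

theorem lampsPoly_unitsAction (w : (LaurentPolynomial (ZMod k))ˣ) (a : Lamps k) :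
    lampsPoly (unitsAction k w a) = w * lampsPoly a := rfl

theorem unitsAction_unitT (m : Multiplicative ℤ) : unitsAction k (unitT k m) = shift k m := by
  ext1 a
  apply lampsPoly_injective
  rw [lampsPoly_shift, lampsPoly_unitsAction, val_unitT]

/-- The affine group of the ring of Laurent polynomials over `ZMod k`. -/
abbrev AffineGroup (k : ℕ) : Type := Lamps k ⋊[unitsAction k] (LaurentPolynomial (ZMod k))ˣ

theorem exists_mulEquiv_affineGroup (hk : Squarefree k) (h2 : 2 ≤ k) :
    ∃ φ : Complement k →* MulAut (LGroup k),
      Nonempty (AffineGroup k ≃* LGroup k ⋊[φ] Complement k) := by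
  obtain ⟨κ, hκ⟩ := exists_complement_units hk h2
  let ι : LGroup k →* AffineGroup k := SemidirectProduct.map (MonoidHom.id _) (unitT k) fun m => by
    rw [unitsAction_unitT]
    rfl
  refine SemidirectProduct.exists_mulEquiv ι (inr.comp κ) ⟨?_⟩ ?_
  · rintro _ ⟨x, rfl⟩ g
    -- Normality: Rˣ is commutative, so conjugation fixes the unit component and L_k is the preimage
    -- of ⟨T⟩.
    have h : (g * ι x * g⁻¹).right = unitT k x.right := by
      simp [ι]
    refine ⟨⟨(g * ι x * g⁻¹).left, x.right⟩, ?_⟩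
    exact SemidirectProduct.ext rfl h.symm
  · constructor
    · rintro ⟨x, c⟩ ⟨y, d⟩ h
      have h1 := congrArg SemidirectProduct.left h
      have h3 := congrArg SemidirectProduct.right h
      have h4 : ((x.right, c) : Multiplicative ℤ × Complement k) = (y.right, d) := hκ.1 h3
      have h5 : x.left = y.left := by simpa [ι] using h1
      exact Prod.ext (SemidirectProduct.ext h5 (congrArg Prod.fst h4)) (congrArg (fun z => z.2) h4)
    · intro g
      obtain ⟨⟨m, c⟩, h⟩ := hκ.2 g.right
      refine ⟨(⟨g.left, m⟩, c), ?_⟩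
      refine SemidirectProduct.ext ?_ h
      simp [ι]

theorem eq_inl_mul_xi_zpow (x : LGroup k) : x = inl x.left * xi k ^ exponent x := by
  have : xi k ^ exponent x = inr x.right := by
    rw [xi, ← map_zpow, ← ofAdd_zsmul]
    simp [exponent]
  rw [this, inl_left_mul_inr_right]

theorem right_xi_zpow (n : ℤ) : (xi k ^ n).right = Multiplicative.ofAdd n := by
  rw [← rightHom_eq_right, map_zpow]
  simp [xi, ← ofAdd_zsmul]

theorem monoidHom_ext {G : Type*} [Group G] {f g : LGroup k →* G}
    (h1 : ∀ a, f (inl a) = g (inl a)) (h2 : f (xi k) = g (xi k)) : f = g := by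
  ext x
  rw [eq_inl_mul_xi_zpow x, map_mul, map_mul, map_zpow, map_zpow, h1, h2]

theorem mul_inl_mul_inv (x : LGroup k) (a : Lamps k) :
    x * inl a * x⁻¹ = inl (shift k x.right a) := by
  ext1
  · simp
  · simp

/-- The endomorphism of the lamplighter group that multiplies the lamps by `g.right` and sends `ξ`
to `g.left * ξ`. -/
noncomputable def affineEnd (g : AffineGroup k) : LGroup k →* LGroup k :=
  SemidirectProduct.lift (inl.comp (unitsAction k g.right).toMonoidHom)
    (zpowersHom (LGroup k) (inl g.left * xi k)) fun m => by
      -- The required compatibility holds because multiplication by a unit commutes with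
      -- multiplication by powers of T.
      refine MonoidHom.ext fun a => ?_
      have h : (zpowersHom (LGroup k) (inl g.left * xi k) m).right = m := by
        rw [zpowersHom_apply, ← rightHom_eq_right, map_zpow, map_mul]
        simp [xi, ← ofAdd_zsmul]
      change inl (unitsAction k g.right (shift k m a)) = _ * inl (unitsAction k g.right a) * _⁻¹
      rw [mul_inl_mul_inv, h, ← unitsAction_unitT, ← MulAut.mul_apply, ← MulAut.mul_apply,
        ← map_mul, ← map_mul, mul_comm]

theorem affineEnd_inl (g : AffineGroup k) (a : Lamps k) :
    affineEnd g (inl a) = inl (unitsAction k g.right a) := lift_inl _ _ _ _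

theorem affineEnd_xi (g : AffineGroup k) : affineEnd g (xi k) = inl g.left * xi k := by
  refine (lift_inr _ _ _ (Multiplicative.ofAdd 1)).trans ?_
  simp

theorem affineEnd_one : affineEnd (1 : AffineGroup k) = MonoidHom.id _ :=
  monoidHom_ext (fun a => by simp [affineEnd_inl]) (by simp [affineEnd_xi])

theorem affineEnd_mul (g h : AffineGroup k) :
    affineEnd (g * h) = (affineEnd g).comp (affineEnd h) :=
  monoidHom_ext (fun a => by simp [affineEnd_inl])
    (by simp [affineEnd_xi, affineEnd_inl, mul_assoc, mul_comm (g.left)])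

/-- The action of the affine group on the lamplighter group. -/
noncomputable def affineAut (k : ℕ) : AffineGroup k →* MulAut (LGroup k) where
  toFun g := MonoidHom.toMulEquiv (affineEnd g) (affineEnd g⁻¹)
    (by rw [← affineEnd_mul, inv_mul_cancel, affineEnd_one])
    (by rw [← affineEnd_mul, mul_inv_cancel, affineEnd_one])
  map_one' := by
    ext1 x
    exact DFunLike.congr_fun affineEnd_one x
  map_mul' g h := by
    ext1 x
    exact DFunLike.congr_fun (affineEnd_mul g h) x

theorem affineAut_apply (g : AffineGroup k) (x : LGroup k) : affineAut k g x = affineEnd g x := rfl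

/-- The image of ξ determines the translation part, and the image of the lamp 1 determines the unit.
-/
theorem affineAut_injective : Function.Injective (affineAut k) := by
  rw [injective_iff_map_eq_one]
  intro g hg
  have h1 := DFunLike.congr_fun hg (xi k)
  rw [affineAut_apply, affineEnd_xi, MulAut.one_apply, mul_eq_right, ← map_one inl] at h1
  have h2 := DFunLike.congr_fun hg (inl (polyLamps 1))
  rw [affineAut_apply, affineEnd_inl, MulAut.one_apply] at h2
  have h3 := congrArg lampsPoly (inl_injective h2)
  rw [lampsPoly_unitsAction, lampsPoly_polyLamps, mul_one] at h3
  exact SemidirectProduct.ext (inl_injective h1) (Units.ext h3)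

/-- The automorphism of the lamplighter group that inverts `ξ` and reflects the lamps. -/
noncomputable def reflection (k : ℕ) : MulAut (LGroup k) :=
  SemidirectProduct.congr (AddEquiv.toMultiplicative (Finsupp.domCongr (Equiv.neg ℤ)))
    (MulEquiv.inv (Multiplicative ℤ)) fun m => by
      ext1 a
      apply Multiplicative.toAdd.injective
      ext n
      change a.toAdd (-m.toAdd + -n) = a.toAdd (- (- -m.toAdd + n))
      congr 1
      ring

theorem reflection_mul_self : reflection k * reflection k = 1 := by
  ext1 x
  refine SemidirectProduct.ext ?_ (inv_inv x.right)
  apply Multiplicative.toAdd.injective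
  ext n
  change x.left.toAdd (- -n) = x.left.toAdd n
  rw [neg_neg]

theorem exponent_reflection_xi : exponent (reflection k (xi k)) = -1 := rfl

/-- The action of the group of order two through the reflection. -/
noncomputable def reflectionHom (k : ℕ) : Multiplicative (ZMod 2) →* MulAut (LGroup k) :=
  AddMonoidHom.toMultiplicativeLeft (ZMod.lift 2
    ⟨zmultiplesHom _ (Additive.ofMul (reflection k)), by
      change (2 : ℤ) • Additive.ofMul (reflection k) = 0
      rw [two_zsmul, ← ofMul_mul, reflection_mul_self, ofMul_one]⟩)

theorem reflectionHom_ofAdd_one : reflectionHom k (Multiplicative.ofAdd 1) = reflection k :=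
  (congrArg Additive.toMul (ZMod.lift_coe 2 _ 1)).trans (zpow_one (reflection k))

/-! ### Finite generation, and the divisibility condition. -/

theorem group_fg_lGroup : Group.FG (LGroup k) := by
  refine Group.fg_iff.2 ⟨{inl (polyLamps 1), xi k}, ?_, by simp⟩
  set S := Subgroup.closure ({inl (polyLamps 1), xi k} : Set (LGroup k)) with hS
  have h1 : inl (polyLamps 1) ∈ S := Subgroup.subset_closure (by simp)
  have h2 : xi k ∈ S := Subgroup.subset_closure (by simp)
  have h3 : ∀ f : LaurentPolynomial (ZMod k), inl (polyLamps f) ∈ S := by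
    intro f
    induction f using LaurentPolynomial.induction_on' with
    | add p q hp hq =>
      rw [polyLamps_add, map_mul]
      exact mul_mem hp hq
    | C_mul_T n a =>
      obtain ⟨a, rfl⟩ := ZMod.intCast_surjective a
      -- Conjugating by ξ^n moves the lamp at 0 to position n, so two generators reach every
      -- monomial.
      have h : (inl (polyLamps (C (a : ZMod k) * T n)) : LGroup k) =
          xi k ^ n * inl (polyLamps 1) ^ a * (xi k ^ n)⁻¹ := by
        rw [← map_zpow, mul_inl_mul_inv, right_xi_zpow]
        congr 1
        apply lampsPoly_injective
        have h5 : lampsPoly (polyLamps (1 : LaurentPolynomial (ZMod k)) ^ a) = C (a : ZMod k) := by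
          change a • (1 : LaurentPolynomial (ZMod k)) = _
          rw [zsmul_eq_mul, mul_one, map_intCast]
        rw [lampsPoly_shift, h5, toAdd_ofAdd, T_mul, lampsPoly_polyLamps]
      rw [h]
      exact mul_mem (mul_mem (zpow_mem h2 n) (zpow_mem h1 a)) (inv_mem (zpow_mem h2 n))
  rw [eq_top_iff]
  intro x _
  rw [eq_inl_mul_xi_zpow x]
  exact mul_mem (h3 (lampsPoly x.left)) (zpow_mem h2 _)

/-- Generators of the subgroup together with representatives of its finitely many cosets generate
the group. -/
theorem group_fg_of_isFiniteExtension {G H : Type*} [Group G] [Group H]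
    (h : IsFiniteExtension G H) (hH : Group.FG H) : Group.FG G := by
  obtain ⟨K, hK, ⟨e⟩⟩ := h
  have hKfg : Group.FG K :=
    Group.fg_of_surjective (f := e.symm.toMonoidHom) e.symm.surjective
  obtain ⟨S, hS, hSf⟩ := (Subgroup.fg_iff K).1 ((Group.fg_iff_subgroup_fg K).1 hKfg)
  refine Group.fg_iff.2 ⟨Set.range (Quotient.out : G ⧸ K → G) ∪ S, ?_,
    Set.Finite.union ?_ hSf⟩
  swap
  · have : Finite (Quotient (QuotientGroup.leftRel K)) := K.finite_quotient_of_finiteIndex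
    exact Set.finite_range _
  rw [Subgroup.closure_union, hS, eq_top_iff]
  intro x _
  have h1 : ((x : G ⧸ K).out)⁻¹ * x ∈ K := QuotientGroup.eq.1 (QuotientGroup.out_eq' _)
  rw [← mul_inv_cancel_left (x : G ⧸ K).out x]
  exact Subgroup.mul_mem_sup (Subgroup.subset_closure ⟨_, rfl⟩) h1

/-- If p² divides k, then p divides k / p, and the condition would make p divide 1. -/
theorem squarefree_of_dvd {k : ℕ} (h0 : k ≠ 0)
    (h : ∀ p : ℕ, p.Prime → p ∣ k → (p : ℤ) ∣ ((k / p : ℕ) : ℤ) ^ 2 - 1) : Squarefree k := by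
  rw [Nat.squarefree_iff_prime_squarefree]
  rintro p hp ⟨m, rfl⟩
  have h1 := h p hp ⟨p * m, by ring⟩
  have h2 : p * p * m / p = p * m := by rw [mul_assoc, Nat.mul_div_cancel_left _ hp.pos]
  rw [h2] at h1
  have h3 : (p : ℤ) ∣ 1 := by
    have h4 : (p : ℤ) ∣ ((p * m : ℕ) : ℤ) ^ 2 := ⟨m * (p * m), by push_cast; ring⟩
    simpa using dvd_sub h4 h1
  exact hp.one_lt.ne' (by exact_mod_cast Int.eq_one_of_dvd_one (by positivity) h3)

theorem group_fg_complement : Group.FG (Complement k) := by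
  have : Group.FG (Multiplicative (Fin (k.primeFactors.card - 1) → ℤ)) := inferInstance
  infer_instance

theorem group_fg_lGroup_complement (φ : Complement k →* MulAut (LGroup k)) :
    Group.FG (LGroup k ⋊[φ] Complement k) :=
  SemidirectProduct.group_fg group_fg_lGroup group_fg_complement

/-! ### Every positive automorphism is affine. -/

variable [NeZero k]

theorem affineAut_mem (g : AffineGroup k) : affineAut k g ∈ autPlus k := by
  change exponent (affineEnd g (xi k)) = 1
  rw [affineEnd_xi]
  simp [exponent, xi]

/-- The Laurent polynomial to which an automorphism sends the lamps `f`. -/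
noncomputable def lampsMap (φ : MulAut (LGroup k)) :
    LaurentPolynomial (ZMod k) →+ LaurentPolynomial (ZMod k) where
  toFun f := lampsPoly (φ (inl (polyLamps f))).left
  map_zero' := by
    change lampsPoly (φ (inl 1)).left = 0
    rw [map_one, map_one]
    rfl
  map_add' f g := by
    rw [polyLamps_add, map_mul, map_mul, mul_left]
    have h : (φ (inl (polyLamps f))).right = 1 := by
      have h2 := exponent_map (NeZero.ne k) φ (inl (polyLamps f))
      exact h2.trans (mul_zero _)
    rw [h]
    simp [lampsPoly_mul]

theorem apply_inl (φ : MulAut (LGroup k)) (a : Lamps k) :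
    φ (inl a) = inl (polyLamps (lampsMap φ (lampsPoly a))) := by
  refine SemidirectProduct.ext rfl ?_
  have h2 := exponent_map (NeZero.ne k) φ (inl a)
  exact h2.trans (mul_zero _)

theorem apply_xi {φ : MulAut (LGroup k)} (hφ : φ ∈ autPlus k) :
    φ (xi k) = inl (φ (xi k)).left * xi k := by
  have h : exponent (φ (xi k)) = 1 := hφ
  conv_lhs => rw [eq_inl_mul_xi_zpow (φ (xi k)), h, zpow_one]

/-- Multiplication by T^n is conjugation by ξ^n, and φ(ξ) = uξ conjugates lamps exactly as ξ does,
since lamps commute. -/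
theorem lampsMap_T_mul {φ : MulAut (LGroup k)} (hφ : φ ∈ autPlus k) (n : ℤ)
    (f : LaurentPolynomial (ZMod k)) : lampsMap φ (T n * f) = T n * lampsMap φ f := by
  have h : (inl (polyLamps (T n * f)) : LGroup k) =
      xi k ^ n * inl (polyLamps f) * (xi k ^ n)⁻¹ := by
    rw [mul_inl_mul_inv]
    congr 1
    apply lampsPoly_injective
    rw [lampsPoly_shift, right_xi_zpow, toAdd_ofAdd, lampsPoly_polyLamps, lampsPoly_polyLamps]
  have h2 : (φ (xi k) ^ n).right = Multiplicative.ofAdd n := by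
    rw [apply_xi hφ, ← rightHom_eq_right, map_zpow]
    simp [xi, ← ofAdd_zsmul]
  have h3 := congrArg φ h
  rw [map_mul, map_mul, map_inv, map_zpow, apply_inl, apply_inl φ (polyLamps f),
    mul_inl_mul_inv, h2] at h3
  have h4 := congrArg lampsPoly (inl_injective h3)
  rwa [lampsPoly_shift] at h4

/-- Scalars of Z/k act as integer multiples, so an additive map commuting with T is R-linear and
determined by its value at 1. -/
theorem lampsMap_apply {φ : MulAut (LGroup k)} (hφ : φ ∈ autPlus k)
    (f : LaurentPolynomial (ZMod k)) : lampsMap φ f = lampsMap φ 1 * f := by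
  induction f using LaurentPolynomial.induction_on' with
  | add p q hp hq => rw [map_add, hp, hq, mul_add]
  | C_mul_T n a =>
    obtain ⟨a, rfl⟩ := ZMod.natCast_zmod_surjective a
    have h : C (a : ZMod k) * T n = a • (T n * 1 : LaurentPolynomial (ZMod k)) := by
      rw [map_natCast, nsmul_eq_mul, mul_one]
    rw [h, map_nsmul, lampsMap_T_mul hφ, nsmul_eq_mul, nsmul_eq_mul]
    ring

theorem lampsMap_mul (φ ψ : MulAut (LGroup k)) (f : LaurentPolynomial (ZMod k)) :
    lampsMap (φ * ψ) f = lampsMap φ (lampsMap ψ f) := by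
  have h := apply_inl (φ * ψ) (polyLamps f)
  rw [MulAut.mul_apply, apply_inl ψ, apply_inl φ] at h
  exact (congrArg lampsPoly (inl_injective h)).symm

theorem lampsMap_one_mul {φ ψ : MulAut (LGroup k)} (hφ : φ ∈ autPlus k) (h : φ * ψ = 1) :
    lampsMap φ 1 * lampsMap ψ 1 = 1 := by
  rw [← lampsMap_apply hφ, ← lampsMap_mul, h]
  rfl

theorem exists_affineAut_eq {φ : MulAut (LGroup k)} (hφ : φ ∈ autPlus k) :
    ∃ g, affineAut k g = φ := by
  have hφ' := inv_mem hφ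
  refine ⟨⟨(φ (xi k)).left, ⟨lampsMap φ 1, lampsMap φ⁻¹ 1,
    lampsMap_one_mul hφ (mul_inv_cancel φ), lampsMap_one_mul hφ' (inv_mul_cancel φ)⟩⟩, ?_⟩
  apply MulEquiv.toMonoidHom_injective
  refine monoidHom_ext (fun a => ?_) ?_
  · change affineEnd _ (inl a) = φ (inl a)
    rw [affineEnd_inl, apply_inl φ]
    exact congrArg (fun f => inl (polyLamps f)) (lampsMap_apply hφ _).symm
  · change affineEnd _ (xi k) = φ (xi k)
    rw [affineEnd_xi, ← apply_xi hφ]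

/-- The positive automorphisms of the lamplighter group form the affine group. -/
noncomputable def affineEquiv (k : ℕ) [NeZero k] : AffineGroup k ≃* autPlus k :=
  MulEquiv.ofBijective ((affineAut k).codRestrict (autPlus k) affineAut_mem)
    ⟨fun _ _ h => affineAut_injective (congrArg Subtype.val h), fun φ => by
      obtain ⟨g, hg⟩ := exists_affineAut_eq φ.2
      exact ⟨g, Subtype.ext hg⟩⟩

/-! ### The sign of an automorphism and the splitting by the reflection. -/

/-- The exponent of `ξ` in its image under an automorphism, which is `1` or `-1`. -/
noncomputable def signHom (k : ℕ) [NeZero k] : MulAut (LGroup k) →* ℤˣ :=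
  MonoidHom.toHomUnits
    { toFun φ := exponent (φ (xi k))
      map_one' := by simp [exponent, xi]
      map_mul' φ _ := exponent_map (NeZero.ne k) φ _ }

theorem ker_signHom : (signHom k).ker = autPlus k := by
  ext φ
  exact Units.ext_iff

theorem autPlus_normal : (autPlus k).Normal :=
  ker_signHom (k := k) ▸ MonoidHom.normal_ker _

theorem autPlus_finiteIndex : (autPlus k).FiniteIndex :=
  ker_signHom (k := k) ▸ Subgroup.finiteIndex_ker _

theorem exponent_apply_xi (φ : MulAut (LGroup k)) :
    exponent (φ (xi k)) = 1 ∨ exponent (φ (xi k)) = -1 :=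
  Int.isUnit_iff.1 (signHom k φ).isUnit

/-- The reflection has order two and sign -1, so it generates a complement to Aut₊. Taking any G
isomorphic to Aut₊ lets one semidirect product serve in both final isomorphisms. -/
theorem exists_mulEquiv_mulAut {G : Type*} [Group G] (e : autPlus k ≃* G) :
    ∃ χ : Multiplicative (ZMod 2) →* MulAut G,
      Nonempty (MulAut (LGroup k) ≃* G ⋊[χ] Multiplicative (ZMod 2)) := by
  have hrange : ((autPlus k).subtype.comp e.symm.toMonoidHom).range = autPlus k := by
    ext φ
    constructor
    · rintro ⟨g, rfl⟩
      exact (e.symm g).2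
    · intro hφ
      exact ⟨e ⟨φ, hφ⟩, congrArg Subtype.val (e.symm_apply_apply ⟨φ, hφ⟩)⟩
  have hC : ∀ c : Multiplicative (ZMod 2), c = 1 ∨ c = Multiplicative.ofAdd 1 := by decide
  have hne : reflection k ∉ autPlus k := fun h => by
    have h1 : exponent (reflection k (xi k)) = 1 := h
    rw [exponent_reflection_xi] at h1
    exact absurd h1 (by decide)
  have hmem : ∀ c, reflectionHom k c ∈ autPlus k → c = 1 := by
    intro c hc
    rcases hC c with rfl | rfl
    · rfl
    · rw [reflectionHom_ofAdd_one] at hc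
      exact absurd hc hne
  refine SemidirectProduct.exists_mulEquiv ((autPlus k).subtype.comp e.symm.toMonoidHom)
    (reflectionHom k) (by rw [hrange]; exact autPlus_normal) ⟨?_, ?_⟩
  · rintro ⟨g, c⟩ ⟨h, d⟩ hx
    change (e.symm g : MulAut (LGroup k)) * reflectionHom k c = e.symm h * reflectionHom k d at hx
    have h1 : c / d = 1 := by
      apply hmem
      have : reflectionHom k (c / d) =
          ((e.symm g)⁻¹ * e.symm h : autPlus k) := by
        rw [map_div, div_eq_iff_eq_mul, Subgroup.coe_mul, mul_assoc, ← hx]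
        simp
      rw [this]
      exact SetLike.coe_mem _
    have h2 : c = d := div_eq_one.1 h1
    subst h2
    have h3 := e.symm.injective (Subtype.ext (mul_right_cancel hx))
    exact Prod.ext h3 rfl
  · intro φ
    rcases exponent_apply_xi φ with h | h
    · refine ⟨(e ⟨φ, h⟩, 1), ?_⟩
      simp
    · have hφ : φ * (reflection k)⁻¹ ∈ autPlus k := by
        change exponent (φ ((reflection k)⁻¹ (xi k))) = 1
        have h2 : (reflection k)⁻¹ = reflection k := inv_eq_of_mul_eq_one_left reflection_mul_self
        rw [exponent_map (NeZero.ne k), h, h2, exponent_reflection_xi]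
        rfl
      refine ⟨(e ⟨_, hφ⟩, Multiplicative.ofAdd 1), ?_⟩
      simp [reflectionHom_ofAdd_one]

theorem squarefree_of_group_fg_autPlus (h : Group.FG (autPlus k)) : Squarefree k := by
  by_contra hk
  refine not_fg_units (NeZero.ne k) hk ?_
  have h1 : Group.FG (AffineGroup k) :=
    Group.fg_of_surjective (f := (affineEquiv k).symm.toMonoidHom) (affineEquiv k).symm.surjective
  exact Group.fg_of_surjective (f := (rightHom : AffineGroup k →* _)) rightHom_surjective

end Lamplighter

theorem mainTheorem2 (k : ℕ) [NeZero k] (hk : 2 ≤ k) :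
    List.TFAE
      [Squarefree k,
        Group.FG (MulAut (Lamplighter.LGroup k)),
        ∃ φ : Lamplighter.Complement k →* MulAut (Lamplighter.LGroup k),
          Lamplighter.IsFiniteExtension (Lamplighter.autPlus k)
            (Lamplighter.LGroup k ⋊[φ] Lamplighter.Complement k)] ∧
    ((∀ p : ℕ, p.Prime → p ∣ k → (p : ℤ) ∣ ((k / p : ℕ) : ℤ) ^ 2 - 1) →
      ∃ φ : Lamplighter.Complement k →* MulAut (Lamplighter.LGroup k),
        Nonempty (Lamplighter.autPlus k ≃*
          Lamplighter.LGroup k ⋊[φ] Lamplighter.Complement k) ∧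
        ∃ χ : Multiplicative (ZMod 2) →*
            MulAut (Lamplighter.LGroup k ⋊[φ] Lamplighter.Complement k),
          Nonempty (MulAut (Lamplighter.LGroup k) ≃*
            (Lamplighter.LGroup k ⋊[φ] Lamplighter.Complement k) ⋊[χ]
              Multiplicative (ZMod 2))) := by
  have key : Squarefree k → ∃ φ : Lamplighter.Complement k →* MulAut (Lamplighter.LGroup k),
      Nonempty (Lamplighter.autPlus k ≃*
        Lamplighter.LGroup k ⋊[φ] Lamplighter.Complement k) := fun h => by
    obtain ⟨φ, ⟨e⟩⟩ := Lamplighter.exists_mulEquiv_affineGroup h hk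
    exact ⟨φ, ⟨(Lamplighter.affineEquiv k).symm.trans e⟩⟩
  constructor
  · tfae_have 1 → 3 := fun h => by
      obtain ⟨φ, ⟨e⟩⟩ := key h
      -- Aut₊ is itself the semidirect product, so the finite index is 1.
      exact ⟨φ, ⊤, inferInstance, ⟨Subgroup.topEquiv.trans e⟩⟩
    tfae_have 3 → 2 := fun ⟨φ, h⟩ => by
      have h1 := Lamplighter.group_fg_of_isFiniteExtension h
        (Lamplighter.group_fg_lGroup_complement φ)
      obtain ⟨χ, ⟨e⟩⟩ := Lamplighter.exists_mulEquiv_mulAut (MulEquiv.refl (Lamplighter.autPlus k))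
      have h2 : Group.FG (Lamplighter.autPlus k ⋊[χ] Multiplicative (ZMod 2)) :=
        SemidirectProduct.group_fg h1 inferInstance
      exact Group.fg_of_surjective (f := e.symm.toMonoidHom) e.symm.surjective
    tfae_have 2 → 1 := fun h => by
      have := Lamplighter.autPlus_finiteIndex (k := k)
      -- The instance is Schreier's lemma: a finite-index subgroup of a finitely generated group is
      -- finitely generated.
      exact Lamplighter.squarefree_of_group_fg_autPlus inferInstance
    tfae_finish
  · intro h
    obtain ⟨φ, ⟨e⟩⟩ := key (Lamplighter.squarefree_of_dvd (NeZero.ne k) h)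
    exact ⟨φ, ⟨e⟩, Lamplighter.exists_mulEquiv_mulAut e⟩
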